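/- Let $p$ be a prime and let $A_p$ be a countably infinite elementary abelian $p$-group (an abelian group with $pa=0$ for all $a\in A_p$). Let $\operatorname{End}(A_p)$ be its endomorphism ring, with composition as multiplication, and let $I$ be the ideal of all endomorphisms of $A_p$ with finite image. Then the ring $\operatorname{End}(A_p)/I$ is simple and von Neumann regular (for every $a$ there is an $x$ with $axa=a$). Moreover, if the continuum hypothesis $2^{\aleph_0}=\aleph_1$ holds, then $\operatorname{End}(A_p)/I$ admits no nondiscrete locally compact Hausdorff ring topology, i.e. no nondiscrete locally compact Hausdorff topology in which addition, negation and multiplication are continuous. -/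

import Mathlib

/-- A ring `R` is von Neumann regular if every `a : R` has the form `a * x * a`. -/
def IsVonNeumannRegular (R : Type*) [Ring R] : Prop :=
  ∀ a : R, ∃ x : R, a * x * a = a

/-- The ideal of the endomorphism ring of an abelian group `A` (multiplication is composition)
which consists of all endomorphisms with finite image. -/
def finiteImageIdeal (A : Type*) [AddCommGroup A] : Ideal (AddMonoid.End A) where
  carrier := {f | (Set.range f).Finite}
  zero_mem' := (Set.finite_singleton (0 : A)).subset (by rintro _ ⟨a, rfl⟩; rfl)
  add_mem' := by
    intro f g hf hg
    refine (hf.add hg).subset ?_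
    rintro _ ⟨a, rfl⟩
    exact ⟨f a, ⟨a, rfl⟩, g a, ⟨a, rfl⟩, rfl⟩
  smul_mem' := by
    intro h f hf
    refine (hf.image h).subset ?_
    rintro _ ⟨a, rfl⟩
    exact ⟨f a, ⟨a, rfl⟩, rfl⟩

instance finiteImageIdeal_isTwoSided (A : Type*) [AddCommGroup A] :
    (finiteImageIdeal A).IsTwoSided where
  mul_mem_of_left := by
    intro f h hf
    refine Set.Finite.subset (s := Set.range f) hf ?_
    rintro _ ⟨a, rfl⟩
    exact ⟨h a, rfl⟩

/-! ### Points with countable neighbourhood bases in locally compact spaces. -/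

open Cardinal Topology Filter Set

/-! An endomorphism with infinite image maps some subspace isomorphically onto a copy of `A`, so
every nonzero `a` in the quotient satisfies `b * a * c = 1`; simplicity follows. Linear splittings
give regularity.

Under CH the quotient has at most `ℵ₁` elements, which forces a locally compact Hausdorff topology
to have a Gδ point. By translation `0` is Gδ, so the ring is first countable with a second countable
neighbourhood `K` of `0`. Almost disjoint sets of basis vectors yield uncountably many orthogonal
idempotents; separability of `K` makes one of them kill a neighbourhood of `0`, and `b * e * c = 1`
then makes `{0}` open. -/

theorem exists_isGδ_singleton_of_mk_le_aleph_one {X : Type*} [TopologicalSpace X] [T2Space X]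
    [LocallyCompactSpace X] [Nonempty X] (hX : #X ≤ ℵ₁) : ∃ x : X, IsGδ ({x} : Set X) := by
  by_contra! hG
  obtain ⟨r, wo, hr⟩ := exists_ord_eq_type_lt X
  have hcount (i : X) : Countable (Iio i) := by
    rw [← mk_le_aleph0_iff, ← lt_aleph_one_iff]
    refine lt_of_lt_of_le ?_ hX
    exact mk_Iio_lt i (by rw [hr])
  -- A nonempty Gδ set `C` is not `{i}`, so a zero set can meet `C` and avoid `i`.
  have hstep (C : Set X) (i : X) : ∃ f : C(X, ℝ),
      (C.Nonempty → IsGδ C → ∃ x ∈ C, f x = 0) ∧ f i = 1 := by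
    by_cases h : C.Nonempty ∧ IsGδ C
    · have : ∃ x ∈ C, x ≠ i := by
        by_contra! h'
        refine hG i ?_
        rw [← h.1.subset_singleton_iff.1 h']
        exact h.2
      obtain ⟨x, hx, hxi⟩ := this
      obtain ⟨f, h0, h1, -⟩ := exists_continuous_zero_one_of_isCompact
        (isCompact_singleton (x := x)) (isClosed_singleton (x := i)) (by simpa using hxi)
      exact ⟨f, fun _ _ => ⟨x, hx, h0 rfl⟩, h1 rfl⟩
    · exact ⟨1, fun h1 h2 => (h ⟨h1, h2⟩).elim, rfl⟩
  choose g hg hg1 using hstep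
  let x₀ : X := Classical.arbitrary X
  obtain ⟨φ, hφ1, -, hφc, -⟩ := exists_continuous_one_zero_of_isCompact
    (isCompact_singleton (x := x₀)) isClosed_empty (disjoint_empty _)
  let K : Set X := φ ⁻¹' {1}
  have hKc : IsCompact K := hφc.isCompact.of_isClosed_subset
    (isClosed_singleton.preimage φ.continuous) fun y hy => subset_tsupport _ (by
      have : φ y = 1 := hy
      simp [this])
  have hzero (f : C(X, ℝ)) (c : ℝ) : IsGδ (f ⁻¹' {c}) :=
    (IsGδ.singleton c).preimage f.continuous
  let wf : WellFounded ((· < ·) : X → X → Prop) := wellFounded_lt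
  -- Stage `i` removes the point `i`. Only countably many stages precede it, so the set stays Gδ;
  -- compactness keeps it nonempty. The intersection over all stages would then be nonempty and yet
  -- miss every point.
  let F : X → C(X, ℝ) := wf.fix fun i rec => g (K ∩ ⋂ j : Iio i, rec j.1 j.2 ⁻¹' {0}) i
  have hF (i : X) : F i = g (K ∩ ⋂ j : Iio i, F j ⁻¹' {0}) i := wf.fix_eq _ i
  have key {ι : Type _} (v : ι → X)
      (h : ∀ k, ∃ x ∈ K, ∀ j, j ≤ v k → F j x = 0) : (K ∩ ⋂ k, F (v k) ⁻¹' {0}).Nonempty := by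
    refine hKc.inter_iInter_nonempty _ (fun k => isClosed_singleton.preimage (F _).continuous) ?_
    intro u
    rcases u.eq_empty_or_nonempty with rfl | hu
    · exact ⟨x₀, hφ1 rfl, by simp⟩
    · obtain ⟨m, hm, hmax⟩ := u.exists_max_image v hu
      obtain ⟨x, hx, hxj⟩ := h m
      exact ⟨x, hx, mem_iInter₂.2 fun k hk => hxj _ (hmax k hk)⟩
  have main (i : X) : ∃ x ∈ K, ∀ j, j ≤ i → F j x = 0 := by
    induction i using wf.induction with
    | _ i ih =>
      have hne := key (fun j : Iio i => (j : X)) fun j => ih j j.2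
      have hgd : IsGδ (K ∩ ⋂ j : Iio i, F j ⁻¹' {0}) :=
        (hzero φ 1).inter (IsGδ.iInter fun j => hzero _ _)
      obtain ⟨x, hx, hx0⟩ := hg _ i hne hgd
      rw [← hF] at hx0
      refine ⟨x, hx.1, fun j hj => ?_⟩
      rcases hj.eq_or_lt with rfl | hj
      · exact hx0
      · exact mem_iInter.1 hx.2 ⟨j, hj⟩
  obtain ⟨y, -, hy⟩ := key id main
  have h0 : F y y = 0 := mem_iInter.1 hy y
  rw [hF, hg1] at h0
  exact one_ne_zero h0

theorem IsGδ.isCountablyGenerated_nhds {X : Type*} [TopologicalSpace X] [T2Space X]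
    [LocallyCompactSpace X] {x : X} (hx : IsGδ ({x} : Set X)) : (𝓝 x).IsCountablyGenerated := by
  obtain ⟨f, hf, -, hfc, hfle⟩ := exists_continuous_one_zero_of_isCompact_of_isGδ
    isCompact_singleton hx isClosed_empty (disjoint_empty _)
  have hf1 : f x = 1 := by
    have : x ∈ f ⁻¹' {1} := hf ▸ mem_singleton x
    exact this
  -- The `+ 2` keeps every level positive, so `V n` lies in the compact support of `f`.
  let V : ℕ → Set X := fun n => f ⁻¹' Ici (1 - 1 / ((n : ℝ) + 2))
  have hpos (n : ℕ) : (0 : ℝ) < 1 / ((n : ℝ) + 2) := by positivity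
  have hlt (n : ℕ) : 1 / ((n : ℝ) + 2) < 1 := by
    rw [div_lt_one (by positivity)]
    linarith [n.cast_nonneg (α := ℝ)]
  have hVn (n : ℕ) : V n ∈ 𝓝 x := f.continuous.continuousAt (Ici_mem_nhds (by
    rw [hf1]; linarith [hpos n]))
  have hVc (n : ℕ) : IsCompact (V n) := hfc.isCompact.of_isClosed_subset
    (isClosed_Ici.preimage f.continuous) fun y hy => subset_tsupport _ (by
      have : 1 - 1 / ((n : ℝ) + 2) ≤ f y := hy
      exact (lt_of_lt_of_le (by linarith [hlt n]) this).ne')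
  have hVanti : Antitone V := fun m n hmn y hy => by
    have h1 : 1 - 1 / ((n : ℝ) + 2) ≤ f y := hy
    have h2 : 1 / ((n : ℝ) + 2) ≤ 1 / ((m : ℝ) + 2) := by gcongr
    exact (by linarith : 1 - 1 / ((m : ℝ) + 2) ≤ f y)
  have hbasis : (𝓝 x).HasBasis (fun _ : ℕ => True) V := by
    refine hasBasis_iff.2 fun U => ⟨fun hU => ?_, fun ⟨n, _, hn⟩ => mem_of_superset (hVn n) hn⟩
    have hV (y : X) (hy : y ∈ ⋂ n, V n) : U ∈ 𝓝 y := by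
      have hlim : Tendsto (fun n : ℕ => 1 - 1 / ((n : ℝ) + 2)) atTop (𝓝 (1 - 0)) :=
        tendsto_const_nhds.sub (tendsto_const_nhds.div_atTop
          (tendsto_atTop_add_const_right _ _ tendsto_natCast_atTop_atTop))
      rw [sub_zero] at hlim
      have hy1 : 1 ≤ f y := le_of_tendsto' hlim fun n => mem_iInter.1 hy n
      have hyx : y ∈ ({x} : Set X) := by
        rw [hf]
        exact le_antisymm (hfle y).2 hy1
      rwa [mem_singleton_iff.1 hyx]
    obtain ⟨n, hn⟩ := exists_subset_nhds_of_isCompact hVanti.directed_ge hVc hV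
    exact ⟨n, trivial, hn⟩
  exact hbasis.isCountablyGenerated

theorem exists_mem_nhds_zero_secondCountableTopology (G : Type*) [AddCommGroup G]
    [TopologicalSpace G] [IsTopologicalAddGroup G] [LocallyCompactSpace G]
    [(𝓝 (0 : G)).IsCountablyGenerated] : ∃ K ∈ 𝓝 (0 : G), SecondCountableTopology K := by
  let : UniformSpace G := IsTopologicalAddGroup.rightUniformSpace G
  have : IsUniformAddGroup G := isUniformAddGroup_of_addCommGroup
  have : (uniformity G).IsCountablyGenerated := IsUniformAddGroup.uniformity_countably_generated
  let : PseudoMetricSpace G := UniformSpace.pseudoMetricSpace G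
  obtain ⟨K, hK, hK0⟩ := exists_compact_mem_nhds (0 : G)
  have : CompactSpace K := isCompact_iff_compactSpace.1 hK
  exact ⟨K, hK0, inferInstance⟩

theorem discreteTopology_of_uncountable_orthogonal_idempotents {R ι : Type*} [Ring R]
    [TopologicalSpace R] [IsTopologicalRing R] [T2Space R]
    [(𝓝 (0 : R)).IsCountablyGenerated] {K : Set R} (hK : K ∈ 𝓝 0) [SecondCountableTopology K]
    (hR : ∀ a : R, a ≠ 0 → ∃ b c, b * a * c = 1) [Uncountable ι] (e : ι → R)
    (hne : ∀ i, e i ≠ 0) (hidem : ∀ i, e i * e i = e i)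
    (horth : Pairwise fun i j => e i * e j = 0) : DiscreteTopology R := by
  obtain ⟨V, hV⟩ := (𝓝 (0 : R)).exists_antitone_basis
  have hmul (a : R) {U : Set R} (hU : U ∈ 𝓝 0) : ∀ᶠ x in 𝓝 (0 : R), a * x ∈ U :=
    (continuous_const_mul a).continuousAt (by simpa using hU)
  have hN (i : ι) : ∃ n, ∀ x ∈ V n, e i * x ∈ K := by
    obtain ⟨n, -, hn⟩ := hV.toHasBasis.mem_iff.1 (hmul (e i) hK)
    exact ⟨n, hn⟩
  choose N hN using hN
  -- Pigeonhole: one `V n` is sent into `K` by uncountably many `e i`.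
  obtain ⟨n, hn⟩ : ∃ n, ¬ (N ⁻¹' {n}).Countable := by
    by_contra! h
    refine not_countable_univ (α := ι) ?_
    rw [← preimage_univ (f := N), ← iUnion_of_singleton, preimage_iUnion]
    exact countable_iUnion h
  -- Multiplying by `e i` kills every `e j * x` with `j ≠ i`, so the nonzero `e i * x` form a
  -- discrete subset of the second countable `K`.
  have hcount (x : R) (hx : x ∈ V n) : {i | N i = n ∧ e i * x ≠ 0}.Countable := by
    let T := {i | N i = n ∧ e i * x ≠ 0}
    let φ : T → K := fun i => ⟨e i * x, hN i x (i.2.1 ▸ hx)⟩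
    let : TopologicalSpace T := TopologicalSpace.induced φ inferInstance
    have : SecondCountableTopology T :=
      TopologicalSpace.secondCountableTopology_induced _ _ φ
    have : DiscreteTopology T := by
      refine discreteTopology_iff_isOpen_singleton.2 fun i => ?_
      refine isOpen_induced_iff.2 ⟨{y : K | e i * (y : R) ≠ 0}, ?_, ?_⟩
      · exact isOpen_ne_fun ((continuous_const_mul _).comp continuous_subtype_val)
          continuous_const
      · ext j
        simp only [mem_preimage, mem_ofPred_eq, mem_singleton_iff, φ, ← mul_assoc]
        constructor
        · intro h
          by_contra hij
          rw [horth fun h' => hij (Subtype.ext h'.symm), zero_mul] at h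
          exact h rfl
        · rintro rfl
          rw [hidem]
          exact j.2.2
    exact TopologicalSpace.separableSpace_iff_countable.1
      (inferInstance : TopologicalSpace.SeparableSpace T)
  have hW : V n ∩ K ∈ 𝓝 (0 : R) := inter_mem (hV.1.mem_of_mem trivial) hK
  have : SecondCountableTopology ↥(V n ∩ K) :=
    (IsEmbedding.inclusion (inter_subset_right : V n ∩ K ⊆ K)).secondCountableTopology
  obtain ⟨D, hDc, hD⟩ := TopologicalSpace.exists_countable_dense ↥(V n ∩ K)
  obtain ⟨i, -, hi⟩ : ∃ i, N i = n ∧ ∀ d ∈ D, e i * (d : R) = 0 := by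
    by_contra! h
    refine hn ((hDc.biUnion fun d _ => hcount d d.2.1).mono fun i hi => ?_)
    obtain ⟨d, hd, hne⟩ := h i hi
    exact mem_iUnion₂.2 ⟨d, hd, hi, hne⟩
  have hann (x : R) (hx : x ∈ V n ∩ K) : e i * x = 0 := by
    have hcl : IsClosed {y : ↥(V n ∩ K) | e i * (y : R) = 0} :=
      isClosed_eq ((continuous_const_mul _).comp continuous_subtype_val) continuous_const
    have := hcl.closure_subset_iff.2 (show D ⊆ _ from hi)
    rw [hD.closure_eq] at this
    exact this (mem_univ ⟨x, hx⟩)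
  obtain ⟨b, c, hbc⟩ := hR _ (hne i)
  refine discreteTopology_of_isOpen_singleton_zero (isOpen_singleton_iff_nhds_eq_pure _ |>.2 ?_)
  refine le_antisymm ?_ (pure_le_nhds 0)
  rw [le_pure_iff]
  filter_upwards [hmul c hW] with x hx
  have := hann _ hx
  rw [mem_singleton_iff, ← one_mul x, ← hbc, mul_assoc, mul_assoc, this, mul_zero]


/-! ### Linear algebra in countable dimension. -/

section LinearAlgebra

variable {K V : Type*} [Field K] [AddCommGroup V] [Module K V]

theorem Module.rank_eq_aleph0_of_finite_of_countable [Finite K] [Countable V] [Infinite V] :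
    Module.rank K V = ℵ₀ := by
  refine le_antisymm ((rank_le_card (R := K) (M := V)).trans (mk_le_aleph0 (α := V))) ?_
  by_contra! h
  have : Module.Finite K V := Module.rank_lt_aleph0_iff.1 h
  have : Finite V := Module.finite_of_finite K
  exact not_finite V

theorem LinearMap.exists_comp_comp_eq_id_of_infinite_range [Finite K] [Countable V] [Infinite V]
    (f : V →ₗ[K] V) (hf : (Set.range f).Infinite) :
    ∃ b c : V →ₗ[K] V, b ∘ₗ f ∘ₗ c = LinearMap.id := by
  have : Infinite (LinearMap.range f) := hf.to_subtype
  have : Countable (LinearMap.range f) := inferInstanceAs (Countable (Set.range f))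
  obtain ⟨φ⟩ : Nonempty (V ≃ₗ[K] LinearMap.range f) := nonempty_linearEquiv_of_rank_eq (by
    rw [Module.rank_eq_aleph0_of_finite_of_countable,
      Module.rank_eq_aleph0_of_finite_of_countable])
  obtain ⟨s, hs⟩ := f.rangeRestrict.exists_rightInverse_of_surjective f.range_rangeRestrict
  obtain ⟨b, hb⟩ := ((LinearMap.range f).subtype ∘ₗ φ.toLinearMap).exists_leftInverse_of_injective
    (LinearMap.ker_eq_bot.2 (Subtype.val_injective.comp φ.injective))
  refine ⟨b, s ∘ₗ φ.toLinearMap, ?_⟩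
  rw [← hb]
  congr 1
  ext x
  exact congrArg Subtype.val (LinearMap.congr_fun hs (φ x))

/-- Take `g` to be a projection onto the range of `f` followed by a linear section of `f`. -/
theorem LinearMap.exists_comp_comp_self_eq_self {W : Type*} [AddCommGroup W] [Module K W]
    (f : V →ₗ[K] W) : ∃ g : W →ₗ[K] V, f ∘ₗ g ∘ₗ f = f := by
  obtain ⟨s, hs⟩ := f.rangeRestrict.exists_rightInverse_of_surjective f.range_rangeRestrict
  obtain ⟨b, hb⟩ := (LinearMap.range f).subtype.exists_leftInverse_of_injective
    (LinearMap.range f).ker_subtype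
  refine ⟨s ∘ₗ b, LinearMap.ext fun x => ?_⟩
  have h1 : b (f x) = f.rangeRestrict x := LinearMap.congr_fun hb (f.rangeRestrict x)
  have h2 := congrArg Subtype.val (LinearMap.congr_fun hs (f.rangeRestrict x))
  simp only [LinearMap.comp_apply, h1]
  exact h2

open Classical in
/-- The projection onto the span of the basis vectors with index in `S` along the span of the
remaining basis vectors. -/
noncomputable def Module.Basis.coordProj {ι : Type*} (b : Module.Basis ι K V) (S : Set ι) :
    V →ₗ[K] V :=
  b.constr K fun i => if i ∈ S then b i else 0

namespace Module.Basis

variable {ι : Type*} (b : Module.Basis ι K V)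

open Classical in
theorem coordProj_apply_basis (S : Set ι) (i : ι) :
    b.coordProj S (b i) = if i ∈ S then b i else 0 :=
  b.constr_basis K _ i

theorem coordProj_comp_coordProj (S T : Set ι) :
    b.coordProj S ∘ₗ b.coordProj T = b.coordProj (S ∩ T) := by
  refine b.ext fun i => ?_
  by_cases hT : i ∈ T <;> by_cases hS : i ∈ S <;> simp [coordProj_apply_basis, hS, hT]

theorem infinite_range_coordProj {S : Set ι} (hS : S.Infinite) :
    (range (b.coordProj S)).Infinite := by
  refine (hS.image b.injective.injOn).mono ?_
  rintro _ ⟨i, hi, rfl⟩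
  exact ⟨b i, by simp [coordProj_apply_basis, hi]⟩

theorem finite_range_coordProj [Finite K] {S : Set ι} (hS : S.Finite) :
    (range (b.coordProj S)).Finite := by
  have : Module.Finite K (Submodule.span K (b '' S)) :=
    Module.Finite.span_of_finite K (hS.image b)
  have hfin : ((Submodule.span K (b '' S) : Submodule K V) : Set V).Finite :=
    Module.finite_of_finite K
  have hle : LinearMap.range (b.coordProj S) ≤ Submodule.span K (b '' S) := by
    rw [LinearMap.range_eq_map, ← b.span_eq, Submodule.map_span_le]
    rintro _ ⟨i, rfl⟩
    rw [coordProj_apply_basis]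
    split_ifs with hi
    · exact Submodule.subset_span ⟨i, hi, rfl⟩
    · exact zero_mem _
  refine hfin.subset ?_
  rintro _ ⟨x, rfl⟩
  exact hle ⟨x, rfl⟩

end Module.Basis

end LinearAlgebra

/-- The set of finite initial segments of a binary sequence. -/
def binaryBranch (α : ℕ → Bool) : Set (List Bool) :=
  range fun n : ℕ => List.ofFn fun i : Fin n => α i

theorem infinite_binaryBranch (α : ℕ → Bool) : (binaryBranch α).Infinite := by
  refine infinite_range_of_injective fun m n h => ?_
  simpa using congrArg List.length h

/-- Common segments are no longer than the first index `k` found where the sequences differ. -/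
theorem finite_binaryBranch_inter {α β : ℕ → Bool} (h : α ≠ β) :
    (binaryBranch α ∩ binaryBranch β).Finite := by
  obtain ⟨k, hk⟩ := Function.ne_iff.1 h
  refine (List.finite_length_le Bool k).subset ?_
  rintro _ ⟨⟨m, rfl⟩, n, hn⟩
  have hmn : n = m := by simpa using congrArg List.length hn
  subst hmn
  by_contra hlt
  simp only [mem_ofPred_eq, List.length_ofFn, not_le] at hlt
  exact hk (congrFun (List.ofFn_injective hn) ⟨k, hlt⟩).symm

/-! ### Algebra and cardinality of the quotient ring. -/

section EndQuotient

variable {A : Type*} [AddCommGroup A]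

/-- The additive endomorphism underlying a linear endomorphism. -/
def LinearMap.toAddMonoidEnd {K : Type*} [Semiring K] [Module K A] (f : A →ₗ[K] A) :
    AddMonoid.End A :=
  f.toAddMonoidHom

theorem mk_finiteImageIdeal_eq_zero_iff {f : AddMonoid.End A} :
    Ideal.Quotient.mk (finiteImageIdeal A) f = 0 ↔ (range f).Finite :=
  Ideal.Quotient.eq_zero_iff_mem

theorem isVonNeumannRegular_end (p : ℕ) [Fact p.Prime] [Module (ZMod p) A] :
    IsVonNeumannRegular (AddMonoid.End A) := fun f => by
  obtain ⟨g, hg⟩ := LinearMap.exists_comp_comp_self_eq_self (AddMonoidHom.toZModLinearMap p f)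
  exact ⟨g.toAddMonoidEnd, AddMonoidHom.ext fun x => LinearMap.congr_fun hg x⟩

theorem IsVonNeumannRegular.quotient {R : Type*} [Ring R] (h : IsVonNeumannRegular R)
    (I : Ideal R) [I.IsTwoSided] : IsVonNeumannRegular (R ⧸ I) := fun a => by
  obtain ⟨a, rfl⟩ := Ideal.Quotient.mk_surjective a
  obtain ⟨x, hx⟩ := h a
  exact ⟨Ideal.Quotient.mk I x, by rw [← map_mul, ← map_mul, hx]⟩

theorem exists_mul_mul_eq_one_end_quotient (p : ℕ) [Fact p.Prime] [Module (ZMod p) A]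
    [Countable A] [Infinite A] (a : AddMonoid.End A ⧸ finiteImageIdeal A) (ha : a ≠ 0) :
    ∃ b c, b * a * c = 1 := by
  obtain ⟨f, rfl⟩ := Ideal.Quotient.mk_surjective a
  obtain ⟨b, c, h⟩ := (AddMonoidHom.toZModLinearMap p f).exists_comp_comp_eq_id_of_infinite_range
    (mt mk_finiteImageIdeal_eq_zero_iff.2 ha)
  refine ⟨Ideal.Quotient.mk _ b.toAddMonoidEnd, Ideal.Quotient.mk _ c.toAddMonoidEnd, ?_⟩
  rw [← map_mul, ← map_mul, ← map_one (Ideal.Quotient.mk (finiteImageIdeal A))]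
  exact congrArg _ (AddMonoidHom.ext fun x => LinearMap.congr_fun h x)

theorem nontrivial_end_quotient [Infinite A] :
    Nontrivial (AddMonoid.End A ⧸ finiteImageIdeal A) := by
  refine ⟨1, 0, fun h => ?_⟩
  rw [← map_one (Ideal.Quotient.mk (finiteImageIdeal A)), mk_finiteImageIdeal_eq_zero_iff] at h
  exact infinite_univ (α := A) (h.subset fun x _ => ⟨x, rfl⟩)

theorem IsSimpleRing.of_exists_mul_mul_eq_one {R : Type*} [Ring R] [Nontrivial R]
    (h : ∀ a : R, a ≠ 0 → ∃ b c, b * a * c = 1) : IsSimpleRing R where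
  simple :=
    { eq_bot_or_eq_top := fun I => by
        refine or_iff_not_imp_left.2 fun hI => ?_
        obtain ⟨a, haI, ha⟩ : ∃ a ∈ I, a ≠ 0 := by
          by_contra! h'
          exact hI (eq_bot_iff.2 fun x hx => by simpa using h' x hx)
        obtain ⟨b, c, hbc⟩ := h a ha
        rw [← TwoSidedIdeal.one_mem_iff, ← hbc]
        exact I.mul_mem_right _ _ (I.mul_mem_left _ _ haI) }

theorem exists_orthogonal_idempotents_end_quotient (p : ℕ) [Fact p.Prime] [Module (ZMod p) A]
    [Countable A] [Infinite A] :
    ∃ e : (ℕ → Bool) → AddMonoid.End A ⧸ finiteImageIdeal A, (∀ α, e α ≠ 0) ∧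
      (∀ α, e α * e α = e α) ∧ Pairwise fun α β => e α * e β = 0 := by
  let _ : Denumerable (List Bool) := Denumerable.ofEncodableOfInfinite _
  obtain ⟨b⟩ : Nonempty (Module.Basis (List Bool) (ZMod p) A) := by
    let b := Module.Basis.ofVectorSpace (ZMod p) A
    have hb := b.mk_eq_rank''
    rw [Module.rank_eq_aleph0_of_finite_of_countable, ← denumerable_iff] at hb
    obtain ⟨_⟩ := hb
    exact ⟨b.reindex (Denumerable.equiv₂ _ _)⟩
  have hcomp (S T : Set (List Bool)) : Ideal.Quotient.mk (finiteImageIdeal A)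
      (b.coordProj S).toAddMonoidEnd * Ideal.Quotient.mk (finiteImageIdeal A)
      (b.coordProj T).toAddMonoidEnd = Ideal.Quotient.mk (finiteImageIdeal A)
      (b.coordProj (S ∩ T)).toAddMonoidEnd := by
    rw [← map_mul, ← b.coordProj_comp_coordProj]
    rfl
  refine ⟨fun α => Ideal.Quotient.mk (finiteImageIdeal A)
    (b.coordProj (binaryBranch α)).toAddMonoidEnd, fun α h => ?_, fun α => ?_, fun α β hαβ => ?_⟩
  · exact b.infinite_range_coordProj (infinite_binaryBranch α)
      (mk_finiteImageIdeal_eq_zero_iff.1 h)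
  · rw [hcomp, inter_self]
  · change _ * _ = _
    rw [hcomp]
    exact mk_finiteImageIdeal_eq_zero_iff.2
      (b.finite_range_coordProj (finite_binaryBranch_inter hαβ))

theorem mk_end_quotient_le_continuum [Countable A] :
    #(AddMonoid.End A ⧸ finiteImageIdeal A) ≤ 𝔠 := by
  refine (mk_le_of_surjective Ideal.Quotient.mk_surjective).trans ?_
  refine (mk_le_of_injective (f := fun f : AddMonoid.End A => (f : A → A))
    DFunLike.coe_injective).trans ?_
  rw [← power_def]
  refine (power_le_power_right (mk_le_aleph0 (α := A))).trans ?_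
  refine (power_le_power_left aleph0_ne_zero (mk_le_aleph0 (α := A))).trans ?_
  rw [aleph0_power_aleph0]

end EndQuotient

theorem theorem4 (p : ℕ) (hp : p.Prime) (A : Type*) [AddCommGroup A]
    (hcount : Countable A) (hinf : Infinite A) (hA : ∀ a : A, p • a = 0) :
    IsSimpleRing (AddMonoid.End A ⧸ finiteImageIdeal A) ∧
    IsVonNeumannRegular (AddMonoid.End A ⧸ finiteImageIdeal A) ∧
    (Cardinal.aleph.{0} 1 = Cardinal.continuum.{0} →
      ¬ ∃ _ : TopologicalSpace (AddMonoid.End A ⧸ finiteImageIdeal A),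
        IsTopologicalRing (AddMonoid.End A ⧸ finiteImageIdeal A) ∧
        T2Space (AddMonoid.End A ⧸ finiteImageIdeal A) ∧
        LocallyCompactSpace (AddMonoid.End A ⧸ finiteImageIdeal A) ∧
        ¬ DiscreteTopology (AddMonoid.End A ⧸ finiteImageIdeal A)) := by
  have : Fact p.Prime := ⟨hp⟩
  let : Module (ZMod p) A := AddCommGroup.zmodModule hA
  have := nontrivial_end_quotient (A := A)
  have hR := exists_mul_mul_eq_one_end_quotient (A := A) p
  refine ⟨.of_exists_mul_mul_eq_one hR, (isVonNeumannRegular_end p).quotient _, ?_⟩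
  rintro hCH ⟨_, _, _, _, hdisc⟩
  have hcard : #(AddMonoid.End A ⧸ finiteImageIdeal A) ≤ ℵ₁ := by
    -- CH is assumed in universe `0` and is lifted to the universe of `A`.
    have := congrArg Cardinal.lift hCH
    rw [lift_continuum, lift_aleph, Ordinal.lift_one] at this
    exact mk_end_quotient_le_continuum.trans this.ge
  obtain ⟨x, hx⟩ := exists_isGδ_singleton_of_mk_le_aleph_one hcard
  have h0 : IsGδ ({0} : Set (AddMonoid.End A ⧸ finiteImageIdeal A)) := by
    convert hx.preimage (continuous_add_const x) using 1
    ext y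
    simp
  have := h0.isCountablyGenerated_nhds
  obtain ⟨K, hK, _⟩ := exists_mem_nhds_zero_secondCountableTopology
    (AddMonoid.End A ⧸ finiteImageIdeal A)
  have : Uncountable (ℕ → Bool) := by
    rw [← aleph0_lt_mk_iff]
    simpa using cantor ℵ₀
  obtain ⟨e, hne, hidem, horth⟩ := exists_orthogonal_idempotents_end_quotient (A := A) p
  exact hdisc (discreteTopology_of_uncountable_orthogonal_idempotents hK hR e hne hidem horth)
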